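/- Let $\{\nu_n\}_{n\in\mathbb{Z}}$ be a family of Borel probability measures on $\mathbb{R}$ whose topological supports are uniformly bounded, i.e. there is $C\in\mathbb{R}$ with $\operatorname{supp}\nu_n\subseteq[-C,C]$ for all $n\in\mathbb{Z}$. Let $V:\mathbb{Z}\to\mathbb{R}$ be a random potential distributed according to the product measure $\mu=\prod_{n\in\mathbb{Z}}\nu_n$ on $\mathbb{R}^{\mathbb{Z}}$ (so the values $V(n)$ are independent and $V(n)$ has law $\nu_n$; the potential $V$ is $\mu$-almost surely bounded). Then there exists a (non-random) compact set $\Sigma\subset\mathbb{R}$ such that, for $\mu$-almost every $V$, the essential spectrum of the bounded self-adjoint discrete Schr\"odinger operator $$[H\psi](n)=\psi(n+1)+\psi(n-1)+V(n)\psi(n)$$ on $\ell^2(\mathbb{Z})$, that is, the set of all $z\in\mathbb{C}$ such that $H-z$ is not a Fredholm operator, is equal to $\Sigma$. -/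

import Mathlib

open scoped ENNReal

/-- The complex Hilbert space `ℓ²(ℤ)`. -/
abbrev EllTwo : Type := lp (fun _ : ℤ => ℂ) 2

/-- A potential `V : ℤ → ℝ` is bounded. -/
def IsBoundedPotential (V : ℤ → ℝ) : Prop := ∃ C : ℝ, ∀ n, |V n| ≤ C

theorem EllTwo.memℓp_iff (f : ℤ → ℂ) :
    Memℓp f 2 ↔ Summable fun n => ‖f n‖ ^ 2 := by
  rw [memℓp_gen_iff (by norm_num)]
  simp

theorem EllTwo.norm_sq (f : EllTwo) : ‖f‖ ^ 2 = ∑' n, ‖f n‖ ^ 2 := by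
  have h := lp.norm_rpow_eq_tsum (p := 2) (by norm_num) f
  simpa using h

theorem EllTwo.summable (f : EllTwo) : Summable fun n => ‖f n‖ ^ 2 :=
  (EllTwo.memℓp_iff _).1 (lp.memℓp f)

/-- The shift `(S_k ψ)(n) = ψ(n + k)` on `ℓ²(ℤ)`, a bounded operator. -/
noncomputable def shiftOp (k : ℤ) : EllTwo →L[ℂ] EllTwo :=
  LinearMap.mkContinuous
    { toFun := fun f => ⟨fun n => f (n + k), (EllTwo.memℓp_iff _).2
        ((Equiv.addRight k).summable_iff.2 (EllTwo.summable f))⟩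
      map_add' := fun _ _ => rfl
      map_smul' := fun _ _ => rfl }
    1
    (fun f => by
      rw [one_mul]
      refine le_of_sq_le_sq ?_ (norm_nonneg _)
      rw [EllTwo.norm_sq, EllTwo.norm_sq]
      exact ((Equiv.addRight k).tsum_eq fun n => ‖f n‖ ^ 2).le)

/-- Multiplication by a bounded real potential, `(V ψ)(n) = V(n) ψ(n)`, as a bounded operator
on `ℓ²(ℤ)`. -/
noncomputable def potentialOp (V : ℤ → ℝ) (hV : IsBoundedPotential V) : EllTwo →L[ℂ] EllTwo :=
  have key : ∀ (f : EllTwo) (n : ℤ), ‖(V n : ℂ) * f n‖ ^ 2 ≤ hV.choose ^ 2 * ‖f n‖ ^ 2 := by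
    intro f n
    rw [norm_mul, mul_pow, Complex.norm_real, Real.norm_eq_abs]
    have := hV.choose_spec n
    gcongr
  LinearMap.mkContinuous
    { toFun := fun f => ⟨fun n => (V n : ℂ) * f n, (EllTwo.memℓp_iff _).2
        (Summable.of_nonneg_of_le (fun _ => by positivity) (key f)
          ((EllTwo.summable f).mul_left _))⟩
      map_add' := fun f g => by
        ext n
        exact mul_add _ _ _
      map_smul' := fun c f => by
        ext n
        exact mul_left_comm _ _ _ }
    hV.choose
    (fun f => by
      have hC : 0 ≤ hV.choose := (abs_nonneg _).trans (hV.choose_spec 0)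
      refine le_of_sq_le_sq ?_ (by positivity)
      rw [mul_pow, EllTwo.norm_sq, EllTwo.norm_sq, ← tsum_mul_left]
      exact Summable.tsum_le_tsum (key f)
        (Summable.of_nonneg_of_le (fun _ => by positivity) (key f)
          ((EllTwo.summable f).mul_left _)) ((EllTwo.summable f).mul_left _))

/-- The discrete one-dimensional Schrödinger operator with bounded potential `V` on `ℓ²(ℤ)`. -/
noncomputable def schrodingerOp (V : ℤ → ℝ) (hV : IsBoundedPotential V) :
    EllTwo →L[ℂ] EllTwo :=
  shiftOp 1 + shiftOp (-1) + potentialOp V hV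

/-- `[H ψ](n) = ψ(n+1) + ψ(n-1) + V(n) ψ(n)`. -/
theorem schrodingerOp_apply (V : ℤ → ℝ) (hV : IsBoundedPotential V) (ψ : EllTwo) (n : ℤ) :
    schrodingerOp V hV ψ n = ψ (n + 1) + ψ (n - 1) + (V n : ℂ) * ψ n :=
  rfl

/-- The essential spectrum of a bounded operator `T`: the set of `z ∈ ℂ` for which `T - z` is
not a Fredholm operator. -/
def essentialSpectrum {E : Type*} [NormedAddCommGroup E] [NormedSpace ℂ E]
    (T : E →L[ℂ] E) : Set ℂ :=
  {z | ¬ ContinuousLinearMap.IsFredholm (T - z • (1 : E →L[ℂ] E))}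

open Filter Topology MeasureTheory ProbabilityTheory

/-! By Weyl's criterion a real `E` is in the essential spectrum of `H` iff for all `r > 0` and `N`
some finitely supported `ψ` vanishing on `[-N, N]` has `‖(H - E)ψ‖ < r‖ψ‖`. One direction uses that
`H - E` bounded below in finite codimension is Fredholm, the other that a Fredholm operator cannot
send weakly null unit vectors to `0` in norm. For fixed `E` and `r`, having such `ψ` for every `N`
does not depend on finitely many values of `V`, so Kolmogorov's law gives it probability 0 or 1.
Rational energies and errors suffice, so almost surely countably many such events all take their
deterministic truth values, and these determine the set. -/

/-! ### Fredholm operators on a Hilbert space -/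

/-- A self-adjoint operator which is bounded below on a closed subspace of finite codimension is
Fredholm. -/
theorem IsSelfAdjoint.isFredholm_of_boundedBelow {E : Type*} [NormedAddCommGroup E]
    [InnerProductSpace ℂ E] [CompleteSpace E] {T : E →L[ℂ] E} (hT : IsSelfAdjoint T)
    (A : Submodule ℂ E) (hA : IsClosed (A : Set E)) [A.CoFG] {c : ℝ} (hc : 0 < c)
    (h : ∀ x ∈ A, c * ‖x‖ ≤ ‖T x‖) : T.IsFredholm := by
  have hanti : AntilipschitzWith (Real.toNNReal c⁻¹) (T.domRestrict A) := by
    refine (T.domRestrict A).antilipschitz_of_bound fun x => ?_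
    rw [Real.coe_toNNReal _ (inv_nonneg.2 hc.le), inv_mul_eq_div, le_div_iff₀' hc]
    exact h x x.2
  have := hA.completeSpace_coe
  have hemb : IsClosedEmbedding (T.domRestrict A) :=
    hanti.isClosedEmbedding (T.domRestrict A).uniformContinuous
  -- Closed range passes from `A` to the whole space because `A` has finite codimension.
  have hstrict := (T.isStrictMap_isClosed_range_iff_restrict A hA).2
    ⟨hemb.isEmbedding.isStrictMap, hemb.isClosed_range⟩
  have hdisj : Disjoint T.ker A := by
    rw [Submodule.disjoint_def]
    intro x hx hxA
    have h0 := h x hxA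
    rw [show T x = 0 from hx, norm_zero] at h0
    have := norm_nonneg x
    exact norm_le_zero_iff.1 (by nlinarith)
  have hker : FiniteDimensional ℂ T.ker := by
    rw [← Submodule.fg_iff_finiteDimensional]
    exact Submodule.CoFG.fg_of_disjoint hdisj ‹A.CoFG›
  refine ⟨hstrict.1, hstrict.2, hker, ?_, ?_⟩
  -- The range is closed and, by self-adjointness, its orthogonal complement is the kernel.
  · have : CompleteSpace T.range := hstrict.2.completeSpace_coe
    refine Submodule.FG.cofg_of_isCompl (Submodule.isCompl_orthogonal (K := T.range)).symm ?_
    have := T.orthogonal_range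
    rw [hT.adjoint_eq] at this
    rw [this]
    exact Submodule.fg_iff_finiteDimensional _ |>.2 hker
  · exact Submodule.ClosedComplemented.of_finiteDimensional _

/-- In an orthonormal basis of the range, the finitely many coefficients of `K y` are inner products
of `y` with fixed vectors. -/
theorem ContinuousLinearMap.tendsto_zero_of_finiteDimensional_range {E ι : Type*} [NormedAddCommGroup E]
    [InnerProductSpace ℂ E] [CompleteSpace E] {l : Filter ι} {K : E →L[ℂ] E}
    (hK : FiniteDimensional ℂ K.range) {x : ι → E}
    (hx : ∀ g, Tendsto (fun k => inner ℂ g (x k)) l (𝓝 0)) :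
    Tendsto (fun k => K (x k)) l (𝓝 0) := by
  let b := stdOrthonormalBasis ℂ K.range
  have hrepr : ∀ y, K y = ∑ i, inner ℂ (K.adjoint (b i)) y • (b i : E) := by
    intro y
    have := congrArg Subtype.val (b.sum_repr' ⟨K y, y, rfl⟩)
    simpa [ContinuousLinearMap.adjoint_inner_left] using this.symm
  simp only [hrepr]
  rw [← Finset.sum_const_zero (s := Finset.univ) (ι := Fin _)]
  refine tendsto_finsetSum _ fun i _ => ?_
  simpa using (hx (K.adjoint (b i))).smul_const (b i : E)

/-- With a quasi-inverse `v`, write `x = v T x - (v T - 1) x`; the last operator has finite rank. -/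
theorem ContinuousLinearMap.IsFredholm.tendsto_zero_of_weak {E ι : Type*} [NormedAddCommGroup E]
    [InnerProductSpace ℂ E] [CompleteSpace E] {l : Filter ι} {T : E →L[ℂ] E}
    (hT : T.IsFredholm) {x : ι → E}
    (hx : ∀ g, Tendsto (fun k => inner ℂ g (x k)) l (𝓝 0))
    (hTx : Tendsto (fun k => T (x k)) l (𝓝 0)) : Tendsto x l (𝓝 0) := by
  obtain ⟨v, hv, -⟩ := hT.exists_isQuasiInverse
  have hfin : FiniteDimensional ℂ (v ∘L T - ContinuousLinearMap.id ℂ E).range :=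
    Module.Finite.iff_fg.2 (LinearMap.FiniteRangeSetoid.equiv_iff_hasFiniteRange.1 hv)
  have h1 := ContinuousLinearMap.tendsto_zero_of_finiteDimensional_range hfin hx
  have h2 := (v.continuous.tendsto 0).comp hTx
  rw [map_zero] at h2
  simpa using h2.sub h1

/-! ### Finitely supported quasimodes -/

/-- The potential `V` has a finitely supported approximate eigenfunction at energy `E`, with
relative error less than `r`, which vanishes on `[-N, N]`. -/
def HasQuasimodeOff (V : ℤ → ℝ) (N : ℕ) (E r : ℝ) : Prop :=
  ∃ (M : ℕ) (ψ : ℤ → ℂ), (∀ n, ψ n ≠ 0 → (N : ℤ) < |n| ∧ |n| < M) ∧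
    ∑ n ∈ Finset.Icc (-(M : ℤ)) M, ‖ψ (n + 1) + ψ (n - 1) + ((V n : ℂ) - E) * ψ n‖ ^ 2 <
      r ^ 2 * ∑ n ∈ Finset.Icc (-(M : ℤ)) M, ‖ψ n‖ ^ 2

theorem HasQuasimodeOff.congr {V W : ℤ → ℝ} {N : ℕ} {E r : ℝ}
    (hVW : ∀ n : ℤ, (N : ℤ) < |n| → V n = W n) (h : HasQuasimodeOff V N E r) :
    HasQuasimodeOff W N E r := by
  obtain ⟨M, ψ, hψ, hlt⟩ := h
  refine ⟨M, ψ, hψ, ?_⟩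
  convert hlt using 5 with n
  by_cases h0 : ψ n = 0
  · simp [h0]
  · rw [hVW n (hψ n h0).1]

theorem HasQuasimodeOff.anti {V : ℤ → ℝ} {N N' : ℕ} {E r : ℝ} (hN : N ≤ N')
    (h : HasQuasimodeOff V N' E r) : HasQuasimodeOff V N E r := by
  obtain ⟨M, ψ, hψ, hlt⟩ := h
  exact ⟨M, ψ, fun n hn => ⟨by have := (hψ n hn).1; omega, (hψ n hn).2⟩, hlt⟩

/-- Each `ψ` gives a strict inequality in finitely many coordinates of `V`. Openness yields
measurability despite the uncountable union over `ψ`. -/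
theorem isOpen_setOf_hasQuasimodeOff (N : ℕ) (E r : ℝ) :
    IsOpen {V : ℤ → ℝ | HasQuasimodeOff V N E r} := by
  simp only [HasQuasimodeOff, Set.ofPred_exists]
  refine isOpen_iUnion fun M => isOpen_iUnion fun ψ => ?_
  rw [Set.ofPred_and]
  exact isOpen_const.inter (isOpen_lt (by fun_prop) continuous_const)

/-! ### The zero-one law -/

/-- The tail `σ`-algebra on `ℤ → ℝ`. -/
abbrev tailSigmaAlgebra : MeasurableSpace (ℤ → ℝ) :=
  limsup (fun n : ℤ => MeasurableSpace.comap (fun V : ℤ → ℝ => V n) inferInstance) cofinite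

theorem measure_infinitePi_tail_zero_or_one (ν : ℤ → Measure ℝ)
    [∀ n, IsProbabilityMeasure (ν n)] {A : Set (ℤ → ℝ)}
    (hA : MeasurableSet[tailSigmaAlgebra] A) :
    Measure.infinitePi ν A = 0 ∨ Measure.infinitePi ν A = 1 := by
  refine measure_zero_or_one_of_measurableSet_limsup (p := Set.Finite)
    (ns := fun s : Finset ℤ => (s : Set ℤ)) (fun n => (measurable_pi_apply n).comap_le)
    (iIndepFun_infinitePi (X := fun _ x => x) fun _ => measurable_id) ?_ ?_ ?_ ?_ hA
  · intro t ht
    exact ht.compl_mem_cofinite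
  · intro s t
    exact ⟨s ∪ t, by simp, by simp⟩
  · exact fun s => s.finite_toSet
  · exact fun n => ⟨{n}, by simp⟩

theorem measurableSet_tail_setOf_forall_hasQuasimodeOff (E r : ℝ) :
    MeasurableSet[tailSigmaAlgebra] {V : ℤ → ℝ | ∀ N, HasQuasimodeOff V N E r} := by
  rw [tailSigmaAlgebra, limsup_eq_iInf_iSup, MeasurableSpace.measurableSet_iInf]
  intro s
  rw [MeasurableSpace.measurableSet_iInf]
  intro hs
  obtain ⟨K, hK⟩ : ∃ K : ℕ, ∀ n : ℤ, (K : ℤ) < |n| → n ∈ s := by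
    obtain ⟨B, hB⟩ := (mem_cofinite.1 hs).image (fun n : ℤ => |n|) |>.bddAbove
    refine ⟨B.toNat, fun n hn => by_contra fun h => ?_⟩
    have := hB ⟨n, h, rfl⟩
    simp only at this
    omega
  -- Quasimodes off `[-(N + K), N + K]` see only sites in `s`, and skipping the first `K` values of
  -- `N` loses nothing by monotonicity.
  have hset : {V : ℤ → ℝ | ∀ N, HasQuasimodeOff V N E r} =
      ⋂ N : ℕ, (fun V : ℤ → ℝ => fun n => if ((N + K : ℕ) : ℤ) < |n| then V n else 0) ⁻¹'
        {V | HasQuasimodeOff V (N + K) E r} := by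
    ext V
    simp only [Set.mem_ofPred_eq, Set.mem_iInter, Set.mem_preimage]
    constructor
    · intro h N
      exact (h (N + K)).congr fun n hn => by rw [if_pos hn]
    · intro h N
      exact ((h N).congr fun n hn => by rw [if_pos hn]).anti (Nat.le_add_right N K)
  rw [hset]
  have hU : ∀ N, MeasurableSet {V | HasQuasimodeOff V N E r} := fun N =>
    (isOpen_setOf_hasQuasimodeOff N E r).measurableSet
  refine @MeasurableSet.iInter _ _ (_) _ _ fun N => ?_
  refine @measurableSet_preimage _ _ (_) _ _ _ ?_ (hU (N + K))
  refine @measurable_pi_lambda _ _ _ (_) _ _ fun n => ?_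
  by_cases hn : ((N + K : ℕ) : ℤ) < |n|
  · simp only [if_pos hn]
    exact (comap_measurable fun V : ℤ → ℝ => V n).mono
      (le_iSup₂_of_le n (hK n (by omega)) le_rfl) le_rfl
  · simp only [if_neg hn]
    exact @measurable_const _ _ _ (_) _

theorem ae_forall_hasQuasimodeOff_iff (ν : ℤ → Measure ℝ) [∀ n, IsProbabilityMeasure (ν n)]
    (E r : ℝ) :
    ∀ᵐ V ∂(Measure.infinitePi ν), (∀ N, HasQuasimodeOff V N E r) ↔
      ∀ᵐ W ∂(Measure.infinitePi ν), ∀ N, HasQuasimodeOff W N E r := by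
  have hmeas : MeasurableSet {V : ℤ → ℝ | ∀ N, HasQuasimodeOff V N E r} := by
    rw [Set.ofPred_forall]
    exact MeasurableSet.iInter fun N => (isOpen_setOf_hasQuasimodeOff N E r).measurableSet
  rcases measure_infinitePi_tail_zero_or_one ν
    (measurableSet_tail_setOf_forall_hasQuasimodeOff E r) with h | h
  · have h1 : ∀ᵐ V ∂(Measure.infinitePi ν), ¬ ∀ N, HasQuasimodeOff V N E r :=
      measure_eq_zero_iff_ae_notMem.1 h
    have h2 : ¬ ∀ᵐ W ∂(Measure.infinitePi ν), ∀ N, HasQuasimodeOff W N E r := by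
      intro h2
      obtain ⟨V, hV, hV'⟩ := (h1.and h2).exists
      exact hV hV'
    filter_upwards [h1] with V hV
    simp only [hV, h2]
  · have h1 : ∀ᵐ V ∂(Measure.infinitePi ν), ∀ N, HasQuasimodeOff V N E r :=
      (prob_compl_eq_zero_iff hmeas).2 h
    filter_upwards [h1] with V hV
    simp only [hV, h1, implies_true]

theorem ae_isBoundedPotential (ν : ℤ → Measure ℝ) [∀ n, IsProbabilityMeasure (ν n)]
    (hsupp : ∃ C : ℝ, ∀ n, (ν n).support ⊆ Set.Icc (-C) C) :
    ∀ᵐ V ∂(Measure.infinitePi ν), IsBoundedPotential V := by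
  obtain ⟨C, hC⟩ := hsupp
  have h : ∀ n, ∀ᵐ V ∂(Measure.infinitePi ν), V n ∈ (ν n).support := fun n =>
    (measurePreserving_eval_infinitePi ν n).quasiMeasurePreserving.ae Measure.support_mem_ae
  filter_upwards [ae_all_iff.2 h] with V hV
  exact ⟨C, fun n => abs_le.2 (hC n (hV n))⟩

/-! ### Self-adjointness and real essential spectrum -/

theorem isSelfAdjoint_schrodingerOp (V : ℤ → ℝ) (hV : IsBoundedPotential V) :
    IsSelfAdjoint (schrodingerOp V hV) := by
  rw [ContinuousLinearMap.isSelfAdjoint_iff_isSymmetric]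
  have hshift : ∀ (k : ℤ) (f g : EllTwo),
      inner ℂ (shiftOp k f) g = inner ℂ f (shiftOp (-k) g) := by
    intro k f g
    rw [lp.inner_eq_tsum, lp.inner_eq_tsum, 
      ← (Equiv.addRight k).tsum_eq fun n => inner ℂ (f n) (shiftOp (-k) g n)]
    refine tsum_congr fun n => ?_
    change inner ℂ (f (n + k)) (g n) = inner ℂ (f (n + k)) (g (n + k + -k))
    rw [add_neg_cancel_right]
  have hpot : ∀ f g : EllTwo,
      inner ℂ (potentialOp V hV f) g = inner ℂ f (potentialOp V hV g) := by
    intro f g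
    rw [lp.inner_eq_tsum, lp.inner_eq_tsum]
    refine tsum_congr fun n => ?_
    change inner ℂ ((V n : ℂ) * f n) (g n) = inner ℂ (f n) ((V n : ℂ) * g n)
    simp only [RCLike.inner_apply, map_mul, Complex.conj_ofReal]
    ring
  intro f g
  change inner ℂ (shiftOp 1 f + shiftOp (-1) f + potentialOp V hV f) g =
    inner ℂ f (shiftOp 1 g + shiftOp (-1) g + potentialOp V hV g)
  rw [inner_add_left, inner_add_left, inner_add_right, inner_add_right, hshift, hshift, hpot,
    neg_neg]
  ring

/-- The essential spectrum of a self-adjoint operator is real. -/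
theorem IsSelfAdjoint.eq_re_of_mem_essentialSpectrum {T : EllTwo →L[ℂ] EllTwo}
    (hT : IsSelfAdjoint T) {z : ℂ} (hz : z ∈ essentialSpectrum T) : z = (z.re : ℂ) := by
  refine hT.mem_spectrum_eq_re fun hu => hz ?_
  rw [spectrum.mem_resolventSet_iff, Algebra.algebraMap_eq_smul_one, IsUnit.sub_iff] at hu
  obtain ⟨u, hu⟩ := hu
  refine .of_isQuasiInverse (v := (↑u⁻¹ : EllTwo →L[ℂ] EllTwo)) ?_
  rw [← hu]
  have h1 : (↑u⁻¹ : EllTwo →L[ℂ] EllTwo).toLinearMap ∘ₗ (u : EllTwo →L[ℂ] EllTwo).toLinearMap =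
    LinearMap.id := congrArg ContinuousLinearMap.toLinearMap u.inv_mul
  have h2 : (u : EllTwo →L[ℂ] EllTwo).toLinearMap ∘ₗ (↑u⁻¹ : EllTwo →L[ℂ] EllTwo).toLinearMap =
    LinearMap.id := congrArg ContinuousLinearMap.toLinearMap u.mul_inv
  constructor
  · rw [LinearMap.IsLeftQuasiInverse, h1]
  · rw [LinearMap.IsRightQuasiInverse, h2]

/-! ### Weyl's criterion -/

/-- The closed subspace of `ℓ²(ℤ)` of the sequences that vanish on `[-N, N]`. -/
noncomputable def vanishingOn (N : ℕ) : Submodule ℂ EllTwo :=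
  (ContinuousLinearMap.pi fun n : Finset.Icc (-(N : ℤ)) N =>
    lp.evalCLM ℂ (fun _ : ℤ => ℂ) 2 (n : ℤ)).ker

theorem mem_vanishingOn {N : ℕ} {f : EllTwo} :
    f ∈ vanishingOn N ↔ ∀ n : ℤ, |n| ≤ N → f n = 0 := by
  simp only [vanishingOn, LinearMap.mem_ker, ContinuousLinearMap.coe_coe, funext_iff, abs_le]
  simp [lp.evalCLM]

theorem isClosed_vanishingOn (N : ℕ) : IsClosed (vanishingOn N : Set EllTwo) :=
  ContinuousLinearMap.isClosed_ker _

instance (N : ℕ) : (vanishingOn N).CoFG := Submodule.CoFG.ker _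

theorem schrodingerOp_sub_smul_apply (V : ℤ → ℝ) (hV : IsBoundedPotential V) (E : ℝ)
    (f : EllTwo) (n : ℤ) :
    (schrodingerOp V hV - (E : ℂ) • (1 : EllTwo →L[ℂ] EllTwo)) f n =
      f (n + 1) + f (n - 1) + ((V n : ℂ) - E) * f n := by
  change schrodingerOp V hV f n - (E : ℂ) * f n = _
  rw [schrodingerOp_apply]
  ring

theorem exists_single_sum_approx (f : EllTwo) {U : Set EllTwo} (hU : U ∈ 𝓝 f) :
    ∃ s : Finset ℤ, ∑ n ∈ s, lp.single 2 n (f n) ∈ U :=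
  ((lp.hasSum_single (by norm_num) f).eventually hU).exists

theorem sum_single_apply (f : EllTwo) (s : Finset ℤ) (n : ℤ) :
    (∑ i ∈ s, lp.single 2 i (f i) : EllTwo) n = if n ∈ s then f n else 0 := by
  rw [lp.coeFn_sum, Finset.sum_apply]
  simp [lp.single_apply, Pi.single_apply]

/-- Finite truncations of `f` converge to `f` and still vanish on `[-N, N]`; the strict inequality
is an open condition, so some truncation satisfies it. -/
theorem hasQuasimodeOff_iff (V : ℤ → ℝ) (hV : IsBoundedPotential V) (N : ℕ) (E : ℝ) {r : ℝ}
    (hr : 0 < r) :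
    HasQuasimodeOff V N E r ↔ ∃ f ∈ vanishingOn N,
      ‖(schrodingerOp V hV - (E : ℂ) • (1 : EllTwo →L[ℂ] EllTwo)) f‖ < r * ‖f‖ := by
  set T := schrodingerOp V hV - (E : ℂ) • (1 : EllTwo →L[ℂ] EllTwo) with hT
  have key : ∀ (M : ℕ) (f : EllTwo), (∀ n, f n ≠ 0 → |n| < M) →
      (∑ n ∈ Finset.Icc (-(M : ℤ)) M, ‖f (n + 1) + f (n - 1) + ((V n : ℂ) - E) * f n‖ ^ 2 <
        r ^ 2 * ∑ n ∈ Finset.Icc (-(M : ℤ)) M, ‖f n‖ ^ 2 ↔ ‖T f‖ < r * ‖f‖) := by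
    intro M f hf
    have h0 : ∀ n, (M : ℤ) ≤ |n| → f n = 0 := fun n hn => by
      by_contra h
      exact absurd (hf n h) (not_lt.2 hn)
    rw [← pow_lt_pow_iff_left₀ (norm_nonneg _) (by positivity) two_ne_zero, mul_pow,
      EllTwo.norm_sq, EllTwo.norm_sq, tsum_eq_sum (s := Finset.Icc (-(M : ℤ)) M),
      tsum_eq_sum (s := Finset.Icc (-(M : ℤ)) M)]
    · simp only [hT, schrodingerOp_sub_smul_apply]
    · intro n hn
      rw [Finset.mem_Icc, ← abs_le, not_le] at hn
      rw [h0 n hn.le]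
      simp
    · intro n hn
      rw [Finset.mem_Icc, ← abs_le, not_le] at hn
      -- Since the support lies strictly inside `(-M, M)`, the hopping terms vanish outside `[-M,
      -- M]` too.
      rw [hT, schrodingerOp_sub_smul_apply, h0 n hn.le, h0 (n + 1), h0 (n - 1)]
      · simp
      · grind
      · grind
  constructor
  · rintro ⟨M, ψ, hψ, hlt⟩
    have hmem : Memℓp ψ 2 := by
      refine (EllTwo.memℓp_iff ψ).2 (summable_of_ne_finset_zero (s := Finset.Icc (-(M : ℤ)) M) ?_)
      intro n hn
      rw [Finset.mem_Icc, ← abs_le] at hn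
      have : ψ n = 0 := by
        by_contra h
        exact hn (hψ n h).2.le
      simp [this]
    refine ⟨⟨ψ, hmem⟩, mem_vanishingOn.2 fun n hn => ?_, (key M ⟨ψ, hmem⟩ fun n hn =>
      (hψ n hn).2).1 hlt⟩
    by_contra h
    exact absurd (hψ n h).1 (not_lt.2 hn)
  · rintro ⟨f, hf, hlt⟩
    have hopen : IsOpen {g : EllTwo | ‖T g‖ < r * ‖g‖} :=
      isOpen_lt (by fun_prop) (by fun_prop)
    obtain ⟨s, hs⟩ := exists_single_sum_approx f (hopen.mem_nhds hlt)
    set g : EllTwo := ∑ n ∈ s, lp.single 2 n (f n) with hg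
    have hgn : ∀ n, g n = if n ∈ s then f n else 0 := sum_single_apply f s
    have hM : ∀ n ∈ s, |n| < ((∑ i ∈ s, i.natAbs + 1 : ℕ) : ℤ) := by
      intro n hn
      have := Finset.single_le_sum (f := Int.natAbs) (fun _ _ => Nat.zero_le _) hn
      rw [Int.abs_eq_natAbs]
      omega
    have hgs : ∀ n, g n ≠ 0 → n ∈ s ∧ f n ≠ 0 := by
      intro n hn
      rw [hgn] at hn
      simpa using hn
    refine ⟨_, g, fun n hn => ⟨?_, hM n (hgs n hn).1⟩, (key _ g fun n hn =>
      hM n (hgs n hn).1).2 hs⟩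
    by_contra h
    exact (hgs n hn).2 (mem_vanishingOn.1 hf n (not_lt.1 h))

/-- `x N` is eventually orthogonal to every finitely supported vector, and these are dense. -/
theorem tendsto_inner_of_mem_vanishingOn {x : ℕ → EllTwo} (hx : ∀ N, x N ∈ vanishingOn N)
    (hx1 : ∀ N, ‖x N‖ = 1) (g : EllTwo) :
    Tendsto (fun N => inner ℂ g (x N)) atTop (𝓝 0) := by
  rw [Metric.tendsto_atTop]
  intro ε hε
  obtain ⟨s, hs⟩ := exists_single_sum_approx g (Metric.ball_mem_nhds g hε)
  set h : EllTwo := ∑ n ∈ s, lp.single 2 n (g n) with hh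
  refine ⟨∑ i ∈ s, i.natAbs, fun N hN => ?_⟩
  have h0 : inner ℂ h (x N) = 0 := by
    rw [lp.inner_eq_tsum]
    refine (tsum_congr fun n => ?_).trans tsum_zero
    rw [hh, sum_single_apply]
    split_ifs with hn
    · have := Finset.single_le_sum (f := Int.natAbs) (fun _ _ => Nat.zero_le _) hn
      rw [mem_vanishingOn.1 (hx N) n (by rw [Int.abs_eq_natAbs]; omega), inner_zero_right]
    · rw [inner_zero_left]
  rw [dist_zero_right, ← sub_zero (inner ℂ g (x N)), ← h0, ← inner_sub_left]
  refine (norm_inner_le_norm _ _).trans_lt ?_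
  rw [hx1, mul_one, ← dist_eq_norm, dist_comm]
  exact hs

/-- **Weyl's criterion** for the essential spectrum of a discrete Schrödinger operator. -/
theorem mem_essentialSpectrum_iff (V : ℤ → ℝ) (hV : IsBoundedPotential V) (E : ℝ) :
    (E : ℂ) ∈ essentialSpectrum (schrodingerOp V hV) ↔
      ∀ r > 0, ∀ N, HasQuasimodeOff V N E r := by
  set T := schrodingerOp V hV - (E : ℂ) • (1 : EllTwo →L[ℂ] EllTwo) with hT
  have hsa : IsSelfAdjoint T := (isSelfAdjoint_schrodingerOp V hV).sub
    (IsSelfAdjoint.smul (Complex.conj_ofReal E) (.one _))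
  change ¬ T.IsFredholm ↔ _
  constructor
  · intro h r hr N
    rw [hasQuasimodeOff_iff V hV N E hr]
    by_contra! hcon
    exact h (hsa.isFredholm_of_boundedBelow (vanishingOn N) (isClosed_vanishingOn N) hr hcon)
  · intro h hF
    have hr : ∀ N : ℕ, (0 : ℝ) < 1 / (N + 1) := fun N => Nat.one_div_pos_of_nat
    choose f hf hlt using fun N : ℕ =>
      (hasQuasimodeOff_iff V hV N E (hr N)).1 (h _ (hr N) N)
    have hpos : ∀ N, 0 < ‖f N‖ := fun N =>
      pos_of_mul_pos_right ((norm_nonneg _).trans_lt (hlt N)) (hr N).le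
    let x : ℕ → EllTwo := fun N => (‖f N‖⁻¹ : ℂ) • f N
    have hx1 : ∀ N, ‖x N‖ = 1 := fun N => by
      simp [x, norm_smul, (hpos N).ne']
    have hxv : ∀ N, x N ∈ vanishingOn N := fun N => Submodule.smul_mem _ _ (hf N)
    have hTx : Tendsto (fun N => T (x N)) atTop (𝓝 0) := by
      refine squeeze_zero_norm (fun N => ?_) (tendsto_one_div_add_atTop_nhds_zero_nat (𝕜 := ℝ))
      simp only [x, map_smul, norm_smul, norm_inv, Complex.norm_real, norm_norm]
      rw [inv_mul_le_iff₀ (hpos N), mul_comm]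
      exact (hlt N).le
    have := (hF.tendsto_zero_of_weak (tendsto_inner_of_mem_vanishingOn hxv hx1) hTx).norm
    simp only [hx1, norm_zero] at this
    exact one_ne_zero (tendsto_nhds_unique tendsto_const_nhds this)

/-! ### Boundedness, rational energies and conclusion -/

theorem abs_le_of_mem_essentialSpectrum (V : ℤ → ℝ) (hV : IsBoundedPotential V) {E : ℝ}
    (hE : (E : ℂ) ∈ essentialSpectrum (schrodingerOp V hV)) :
    |E| ≤ ‖schrodingerOp V hV‖ + 1 := by
  obtain ⟨f, -, hf⟩ := (hasQuasimodeOff_iff V hV 0 E one_pos).1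
    ((mem_essentialSpectrum_iff V hV E).1 hE 1 one_pos 0)
  rw [one_mul] at hf
  have hpos : 0 < ‖f‖ := (norm_nonneg _).trans_lt hf
  have h1 := norm_sub_norm_le ((E : ℂ) • f) (schrodingerOp V hV f)
  rw [norm_sub_rev, norm_smul, Complex.norm_real, Real.norm_eq_abs] at h1
  have h2 := (schrodingerOp V hV).le_opNorm f
  have h3 : ‖schrodingerOp V hV f - (E : ℂ) • f‖ < ‖f‖ := hf
  nlinarith

theorem HasQuasimodeOff.of_abs_sub_lt {V : ℤ → ℝ} (hV : IsBoundedPotential V) {N : ℕ}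
    {E q r ε : ℝ} (hr : 0 < r) (hε : |q - E| < ε) (h : HasQuasimodeOff V N E r) :
    HasQuasimodeOff V N q (r + ε) := by
  have hε0 : 0 < ε := (abs_nonneg _).trans_lt hε
  obtain ⟨f, hf, hlt⟩ := (hasQuasimodeOff_iff V hV N E hr).1 h
  refine (hasQuasimodeOff_iff V hV N q (by positivity)).2 ⟨f, hf, ?_⟩
  have hdec : (schrodingerOp V hV - (q : ℂ) • (1 : EllTwo →L[ℂ] EllTwo)) f =
      (schrodingerOp V hV - (E : ℂ) • (1 : EllTwo →L[ℂ] EllTwo)) f - ((q - E : ℝ) : ℂ) • f := by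
    change schrodingerOp V hV f - (q : ℂ) • f = schrodingerOp V hV f - (E : ℂ) • f - _
    rw [Complex.ofReal_sub, sub_smul]
    abel
  rw [hdec, add_mul]
  refine (norm_sub_le _ _).trans_lt (add_lt_add_of_lt_of_le hlt ?_)
  rw [norm_smul, Complex.norm_real, Real.norm_eq_abs]
  gcongr

/-- Moving the energy by less than `ε` adds `ε` to the relative error, hence `2 * ε`. The conditions
become countable in number. -/
theorem mem_essentialSpectrum_iff_rat (V : ℤ → ℝ) (hV : IsBoundedPotential V) (E : ℝ) :
    (E : ℂ) ∈ essentialSpectrum (schrodingerOp V hV) ↔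
      ∀ q ε : ℚ, |(q : ℝ) - E| < ε → ∀ N, HasQuasimodeOff V N q (2 * ε) := by
  rw [mem_essentialSpectrum_iff]
  constructor
  · intro h q ε hq N
    have hε0 : (0 : ℝ) < ε := (abs_nonneg _).trans_lt hq
    rw [two_mul]
    exact (h ε hε0 N).of_abs_sub_lt hV hε0 hq
  · intro h r hr N
    -- `ε < r / 3` gives `ε < r - 2 * ε`, so returning from `q` to `E` leaves a total error of `r`.
    obtain ⟨ε, hε0, hε⟩ := exists_rat_btwn (show (0 : ℝ) < r / 3 by positivity)
    obtain ⟨q, hq1, hq2⟩ := exists_rat_btwn (show E < E + (r / 3 - ε) ⊓ ε by simp [hε0, hε])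
    have hq3 := lt_min_iff.1 (sub_lt_iff_lt_add'.2 hq2)
    have hq : |(q : ℝ) - E| < ε := by
      rw [abs_of_pos (sub_pos.2 hq1)]
      exact hq3.2
    have := (h q ε hq N).of_abs_sub_lt hV (q := E) (ε := r - 2 * ε) (by positivity) (by
      rw [abs_sub_comm]
      linarith)
    simpa using this

theorem theoremt (ν : ℤ → MeasureTheory.Measure ℝ)
    [∀ n, MeasureTheory.IsProbabilityMeasure (ν n)]
    (hsupp : ∃ C : ℝ, ∀ n, (ν n).support ⊆ Set.Icc (-C) C) :
    ∃ S : Set ℝ, IsCompact S ∧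
      ∀ᵐ V ∂(MeasureTheory.Measure.infinitePi ν),
        ∃ hV : IsBoundedPotential V,
          essentialSpectrum (schrodingerOp V hV) = Complex.ofReal '' S := by
  let S : Set ℝ := {E | ∀ q ε : ℚ, |(q : ℝ) - E| < ε →
    ∀ᵐ W ∂(Measure.infinitePi ν), ∀ N, HasQuasimodeOff W N q (2 * ε)}
  have hae : ∀ᵐ V ∂(Measure.infinitePi ν), ∃ hV : IsBoundedPotential V,
      essentialSpectrum (schrodingerOp V hV) = Complex.ofReal '' S := by
    have hrat := ae_all_iff.2 fun p : ℚ × ℚ =>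
      ae_forall_hasQuasimodeOff_iff ν (p.1 : ℝ) (2 * p.2)
    filter_upwards [ae_isBoundedPotential ν hsupp, hrat] with V hV hVrat
    have hmem : ∀ E : ℝ, (E : ℂ) ∈ essentialSpectrum (schrodingerOp V hV) ↔ E ∈ S := fun E => by
      rw [mem_essentialSpectrum_iff_rat]
      exact forall₂_congr fun q ε => imp_congr_right fun _ => hVrat (q, ε)
    refine ⟨hV, Set.ext fun z => ⟨fun hz => ?_, ?_⟩⟩
    · have hzre := (isSelfAdjoint_schrodingerOp V hV).eq_re_of_mem_essentialSpectrum hz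
      rw [hzre] at hz
      exact ⟨z.re, (hmem _).1 hz, hzre.symm⟩
    · rintro ⟨E, hE, rfl⟩
      exact (hmem E).2 hE
  refine ⟨S, Metric.isCompact_of_isClosed_isBounded ?_ ?_, hae⟩
  · simp only [S, Set.ofPred_forall]
    refine isClosed_iInter fun q => isClosed_iInter fun ε => ?_
    -- The conclusion of each condition is independent of `E`, and its premise is open in `E`.
    exact isClosed_imp (isOpen_lt (by fun_prop) continuous_const) isClosed_const
  -- A single good `V` bounds `S` by its own operator norm.
  · obtain ⟨V, hV, hVS⟩ := hae.exists
    refine (Metric.isBounded_Icc (-(‖schrodingerOp V hV‖ + 1)) (‖schrodingerOp V hV‖ + 1)).subset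
      fun E hE => abs_le.1 (abs_le_of_mem_essentialSpectrum V hV ?_)
    rw [hVS]
    exact ⟨E, hE, rfl⟩
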